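/- Let $d\ge 1$, write $|n|=\max_{\nu}|n_\nu|$ and $\langle n\rangle=(1+|n|^2)^{1/2}$ for $n\in\mathbb Z^d$, let $V:\mathbb Z^d\to\mathbb R$ be bounded, and let $H$ be the Schrödinger operator $$(Hu)(n)=\sum_{i=1}^{d}\big(u(n+e_i)+u(n-e_i)\big)+V(n)\,u(n),$$ a bounded self-adjoint operator on $\ell^2(\mathbb Z^d)$. For $q>0$, $k\in\mathbb Z^d$ and $T>0$ put $$\mathcal M_{q;k}(T)=\frac1T\int_0^\infty e^{-t/T}\,\big\langle\delta_k,e^{iHt}\langle X\rangle^{q}e^{-iHt}\delta_k\big\rangle\,dt=\frac1T\int_0^\infty e^{-t/T}\sum_{n\in\mathbb Z^d}\langle n\rangle^{q}\,\big|(e^{-iHt}\delta_k)(n)\big|^2\,dt\in[0,\infty].$$ Let $I\subset\mathbb R$ be a set of positive Lebesgue measure and let $k\in\mathbb Z^d$. Suppose that for Lebesgue almost every $E\in I$ there is a bounded function $\psi_E:\mathbb Z^d\to\mathbb C$ (with a bound that may depend on $E$) such that $H\psi_E=E\psi_E$ pointwise on $\mathbb Z^d$ and $\psi_E(k)\neq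 0$. Then: 1. for every $q>d$ there is a constant $C>0$ such that $\mathcal M_{q;k}(T)\ge C\,T$ for all $T>0$; 2. for every $q$ with $d-1<q\le d$ and every real $r<1+q-d$ there is a constant $C>0$ such that $\mathcal M_{q;k}(T)\ge C\,T^{r}$ for all $T>0$ if $r\ge 0$, and for all $T\ge 1$ if $r<0$. The constants $C$ do not depend on $T$. -/

import Mathlib

open MeasureTheory
open scoped ENNReal

noncomputable section

namespace LatticeTransport

/-- The lattice `ℤ^d`. The norm `‖n‖` it carries as a pi type is `max_ν |n_ν|`. -/
abbrev Lattice (d : ℕ) : Type := Fin d → ℤ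

/-- The Hilbert space `ℓ²(ℤ^d)`. -/
abbrev L2 (d : ℕ) : Type := lp (fun _ : Lattice d => ℂ) 2

/-- The standard unit vector `e_i` of `ℤ^d`. -/
def unitVec {d : ℕ} (i : Fin d) : Lattice d := Pi.single i 1

/-- The difference expression `(H_V u)(n) = ∑_{j nearest neighbour of 0} u (n + j) + V n * u n`,
for an arbitrary function `u` on the lattice. -/
def schrodinger {d : ℕ} (V : Lattice d → ℝ) (u : Lattice d → ℂ) (n : Lattice d) : ℂ :=
  (∑ i : Fin d, (u (n + unitVec i) + u (n - unitVec i))) + (V n : ℂ) * u n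

/-- Solutions `u : ℤ^d → ℂ`, not necessarily square summable, of `H_V u = E u`. -/
def IsGeneralizedEigenfunction {d : ℕ} (V : Lattice d → ℝ) (E : ℂ) (u : Lattice d → ℂ) : Prop :=
  ∀ n, schrodinger V u n = E * u n

/-- A bounded real function on the lattice. -/
def IsBoundedPotential {d : ℕ} (V : Lattice d → ℝ) : Prop := ∃ B : ℝ, ∀ n, |V n| ≤ B

theorem memℓp_two_iff {d : ℕ} (u : Lattice d → ℂ) :
    Memℓp u 2 ↔ Summable fun n => ‖u n‖ ^ 2 := by
  rw [memℓp_gen_iff (by norm_num)]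
  simp

theorem norm_sq_eq_tsum {d : ℕ} (u : L2 d) : ‖u‖ ^ 2 = ∑' n, ‖u n‖ ^ 2 := by
  have := lp.norm_rpow_eq_tsum (p := 2) (by norm_num) u
  simpa using this

theorem memℓp_shift {d : ℕ} (j : Lattice d) (u : L2 d) :
    Memℓp (fun n => u (n + j)) 2 := by
  rw [memℓp_two_iff]
  exact ((memℓp_two_iff _).1 (lp.memℓp u)).comp_injective (add_left_injective j)

/-- The translation `(τ_j u)(n) = u (n + j)` on `ℓ²(ℤ^d)`. -/
def shiftOp {d : ℕ} (j : Lattice d) : L2 d →L[ℂ] L2 d :=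
  LinearMap.mkContinuous
    { toFun := fun u => ⟨fun n => u (n + j), memℓp_shift j u⟩
      map_add' := fun _ _ => rfl
      map_smul' := fun _ _ => rfl } 1 (by
      intro u
      rw [one_mul]
      refine le_of_sq_le_sq ?_ (norm_nonneg _)
      rw [norm_sq_eq_tsum, norm_sq_eq_tsum]
      exact ((Equiv.addRight j).tsum_eq fun n => ‖u n‖ ^ 2).le)

theorem memℓp_mul {d : ℕ} {V : Lattice d → ℝ} (hV : IsBoundedPotential V) (u : L2 d) :
    Memℓp (fun n => (V n : ℂ) * u n) 2 := by
  obtain ⟨B, hB⟩ := hV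
  rw [memℓp_two_iff]
  refine Summable.of_nonneg_of_le (fun n => by positivity) (fun n => ?_)
    (((memℓp_two_iff _).1 (lp.memℓp u)).mul_left (B ^ 2))
  rw [norm_mul, Complex.norm_real, Real.norm_eq_abs, mul_pow]
  gcongr
  exact hB n

/-- The operator of multiplication by a bounded real function on `ℓ²(ℤ^d)`. -/
def mulOp {d : ℕ} (V : Lattice d → ℝ) (hV : IsBoundedPotential V) : L2 d →L[ℂ] L2 d :=
  LinearMap.mkContinuousOfExistsBound
    { toFun := fun u => ⟨fun n => (V n : ℂ) * u n, memℓp_mul hV u⟩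
      map_add' := fun u v => by ext n; exact mul_add _ _ _
      map_smul' := fun c u => by ext n; exact mul_left_comm _ _ _ } (by
      obtain ⟨B, hB⟩ := hV
      refine ⟨|B|, fun u => ?_⟩
      refine le_of_sq_le_sq ?_ (by positivity)
      rw [mul_pow, norm_sq_eq_tsum, norm_sq_eq_tsum, ← tsum_mul_left]
      refine Summable.tsum_le_tsum (fun n => ?_)
        ((memℓp_two_iff _).1 (memℓp_mul ⟨B, hB⟩ u))
        (((memℓp_two_iff _).1 (lp.memℓp u)).mul_left _)
      simp only [LinearMap.coe_mk, AddHom.coe_mk]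
      rw [norm_mul, Complex.norm_real, Real.norm_eq_abs, mul_pow]
      exact mul_le_mul_of_nonneg_right
        (pow_le_pow_left₀ (abs_nonneg _) ((hB n).trans (le_abs_self B)) 2) (by positivity))

/-- The bounded Schrödinger operator `H_V = H_0 + V` on `ℓ²(ℤ^d)`. -/
def schrodingerOp {d : ℕ} (V : Lattice d → ℝ) (hV : IsBoundedPotential V) : L2 d →L[ℂ] L2 d :=
  (∑ i : Fin d, (shiftOp (unitVec i) + shiftOp (-unitVec i))) + mulOp V hV

/-- The operator on `ℓ²(ℤ^d)` acts by the difference expression. -/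
theorem schrodingerOp_apply {d : ℕ} (V : Lattice d → ℝ) (hV : IsBoundedPotential V)
    (u : L2 d) (n : Lattice d) : schrodingerOp V hV u n = schrodinger V u n := by
  simp only [schrodingerOp, schrodinger, add_apply,
    sum_apply, lp.coeFn_add, lp.coeFn_sum, Pi.add_apply, Finset.sum_apply]
  rfl

/-- The vector `δ_k`. -/
def delta {d : ℕ} (k : Lattice d) : L2 d := lp.single 2 k (1 : ℂ)

/-- The unitary evolution `e^{-itH_V}` (norm-convergent exponential series). -/
def evolution {d : ℕ} (V : Lattice d → ℝ) (hV : IsBoundedPotential V) (t : ℝ) :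
    L2 d →L[ℂ] L2 d :=
  NormedSpace.exp ((-(Complex.I * (t : ℂ))) • schrodingerOp V hV)

/-- The expectation `⟨u, φ(X) u⟩ = ∑_n φ n |u n|²` of the multiplication operator `φ(X)`, for a
nonnegative function `φ`, in the state `u`, as an element of `[0, ∞]`. -/
def expectation {d : ℕ} (φ : Lattice d → ℝ) (u : L2 d) : ℝ≥0∞ :=
  ∑' n, ENNReal.ofReal (φ n * ‖u n‖ ^ 2)

/-- The transport function
`𝓜_{φ;k}(T) = (1/T) ∫_0^∞ e^{-t/T} ⟨δ_k, e^{itH_V} φ(X) e^{-itH_V} δ_k⟩ dt`,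
with the integrand written as `⟨u_t, φ(X) u_t⟩` for `u_t = e^{-itH_V} δ_k`. -/
def transport {d : ℕ} (V : Lattice d → ℝ) (hV : IsBoundedPotential V)
    (φ : Lattice d → ℝ) (k : Lattice d) (T : ℝ) : ℝ≥0∞ :=
  ENNReal.ofReal (1 / T) * ∫⁻ t in Set.Ioi (0 : ℝ),
    ENNReal.ofReal (Real.exp (-t / T)) * expectation φ (evolution V hV t (delta k))

/-- `⟨n⟩ = (1 + |n|²)^{1/2}` with the maximum norm `|n|`. -/
def japaneseBracket {d : ℕ} (n : Lattice d) : ℝ := Real.sqrt (1 + ‖n‖ ^ 2)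

/-- The averaged `q`-th moment `𝓜_{q;k}(T) = 𝓜_{⟨x⟩^q;k}(T)`. -/
def moment {d : ℕ} (V : Lattice d → ℝ) (hV : IsBoundedPotential V)
    (q : ℝ) (k : Lattice d) (T : ℝ) : ℝ≥0∞ :=
  transport V hV (fun n => japaneseBracket n ^ q) k T

theorem inner_eq {d : ℕ} (u v : L2 d) :
    inner ℂ u v = ∑' n, v n * (starRingEnd ℂ) (u n) := by
  rw [lp.inner_eq_tsum]
  rfl

theorem isSelfAdjoint_schrodingerOp {d : ℕ} (V : Lattice d → ℝ) (hV : IsBoundedPotential V) :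
    IsSelfAdjoint (schrodingerOp V hV) := by
  have hs : ∀ j : Lattice d, star (shiftOp j) = shiftOp (-j) := by
    intro j
    rw [ContinuousLinearMap.star_eq_adjoint, eq_comm, ContinuousLinearMap.eq_adjoint_iff]
    intro u v
    rw [inner_eq, inner_eq, ← (Equiv.addRight j).tsum_eq]
    refine tsum_congr fun n => ?_
    change v (n + j) * (starRingEnd ℂ) (u (n + j + -j)) = v (n + j) * _
    rw [add_neg_cancel_right]
  have hm : star (mulOp V hV) = mulOp V hV := by
    rw [ContinuousLinearMap.star_eq_adjoint, eq_comm, ContinuousLinearMap.eq_adjoint_iff]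
    intro u v
    rw [inner_eq, inner_eq]
    refine tsum_congr fun n => ?_
    change v n * (starRingEnd ℂ) ((V n : ℂ) * u n) = ((V n : ℂ) * v n) * (starRingEnd ℂ) (u n)
    rw [map_mul, Complex.conj_ofReal]
    ring
  rw [IsSelfAdjoint, schrodingerOp, star_add, star_sum, hm]
  congr 1
  refine Finset.sum_congr rfl fun i _ => ?_
  rw [star_add, hs, hs, neg_neg, add_comm]

/-- Whenever `w = φ(X) e^{-itH} δ_k` is an element of `ℓ²(ℤ^d)`, the integrand of `transport` is
the matrix element `⟨δ_k, e^{itH} φ(X) e^{-itH} δ_k⟩`. -/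
theorem expectation_evolution_eq_inner {d : ℕ} (V : Lattice d → ℝ) (hV : IsBoundedPotential V)
    (φ : Lattice d → ℝ) (hφ : ∀ n, 0 ≤ φ n) (k : Lattice d) (t : ℝ) (w : L2 d)
    (hw : ∀ n, w n = (φ n : ℂ) * evolution V hV t (delta k) n) :
    (ENNReal.toReal (expectation φ (evolution V hV t (delta k))) : ℂ) =
      inner ℂ (delta k) (evolution V hV (-t) w) := by
  have hstar : star (evolution V hV t) = evolution V hV (-t) := by
    rw [evolution, evolution, NormedSpace.star_exp, star_smul,
      (isSelfAdjoint_schrodingerOp V hV).star_eq]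
    congr 2
    simp
  rw [← hstar, ContinuousLinearMap.star_eq_adjoint, ContinuousLinearMap.adjoint_inner_right,
    inner_eq, expectation,
    ENNReal.tsum_toReal_eq (fun _ => ENNReal.ofReal_ne_top), Complex.ofReal_tsum]
  refine tsum_congr fun n => ?_
  rw [hw, ENNReal.toReal_ofReal (mul_nonneg (hφ n) (by positivity)), mul_assoc,
    Complex.mul_conj, Complex.normSq_eq_norm_sq]
  push_cast
  rfl

end LatticeTransport

end

noncomputable section

namespace LatticeTransport

open ProbabilityTheory

/-! Write `u_t = e^{-itH} δ_k`. A bounded solution `ψ` of `Hψ = Eψ` lies only in `ℓ^∞`, but `u_t`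
decays exponentially, so the pairing `∑ ψ(n) u_t(n)` converges and equals `e^{-itE} ψ(k)`.
Multiplying by `e^{itE}` and integrating over `(0, T]` cancels the phase: the amplitudes `g_E(n) =
∫_0^T e^{itE} u_t(n) dt` satisfy `∑ ψ(n) g_E(n) = T ψ(k)` (`tsum_mul_energyAmplitude`). If `|ψ| ≤ N
|ψ(k)|`, then `T ≤ N ∑ |g_E(n)|`.

Propagation is at most ballistic, so sites with `|n - k| > aT + b` contribute at most `T/2` to the
right side. On the ball, Cauchy–Schwarz with a weight `φ` gives `∑ φ |g_E|² ≥ T² / (4 N² S)`, where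
`S` bounds `∑ 1/φ` over the ball (`le_tsum_weight_energyAmplitude`).

Averaging over `E` against a Gaussian measure, a Bessel inequality (`lintegral_truncatedFourier_le`)
bounds the average of `∑ φ |g_E|²` by a constant times `∫_0^T ∑ φ |u_t|² dt`. The good energies have
positive measure, and division by `T` yields transport at least `c T / S` (`exists_le_transport`).
For `φ = ⟨n⟩^q`, `S` is bounded if `q > d`, and is `O(T^{1-r})` for `T ≥ 1` if `q ≤ d` and `r < 1 +
q - d`. -/

/-! ### Exponentially weighted `ℓ¹` bounds: propagation is at most ballistic. -/

theorem norm_unitVec_le {d : ℕ} (i : Fin d) : ‖(unitVec i : Lattice d)‖ ≤ 1 := by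
  refine (pi_norm_le_iff_of_nonneg zero_le_one).2 fun j => ?_
  rcases eq_or_ne j i with rfl | h
  · simp [unitVec]
  · simp [unitVec, h]

/-- The `ℓ¹` norm of `v` with the exponential weight `e^{|n - k|}`. -/
def expWeightedNorm {d : ℕ} (k : Lattice d) (v : Lattice d → ℂ) : ℝ≥0∞ :=
  ∑' n, ENNReal.ofReal (Real.exp ‖n - k‖) * ‖v n‖ₑ

theorem expWeightedNorm_shift_le {d : ℕ} (k j : Lattice d) (hj : ‖j‖ ≤ 1) (v : Lattice d → ℂ) :
    expWeightedNorm k (fun n => v (n + j)) ≤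
      ENNReal.ofReal (Real.exp 1) * expWeightedNorm k v := by
  rw [expWeightedNorm, expWeightedNorm, ← ENNReal.tsum_mul_left,
    ← (Equiv.addRight j).tsum_eq fun n => ENNReal.ofReal (Real.exp 1) * _]
  refine ENNReal.tsum_le_tsum fun n => ?_
  rw [← mul_assoc, ← ENNReal.ofReal_mul (Real.exp_pos _).le, ← Real.exp_add]
  refine mul_le_mul_left (ENNReal.ofReal_le_ofReal (Real.exp_le_exp.2 ?_)) _
  have : n - k = (n + j - k) - j := by abel
  calc ‖n - k‖ ≤ ‖n + j - k‖ + ‖j‖ := by rw [this]; exact norm_sub_le _ _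
    _ ≤ 1 + ‖Equiv.addRight j n - k‖ := by
      rw [Equiv.coe_addRight]; linarith

/-- Moving to a neighbouring site changes the weight by a factor at most `e`, so each of the `2d`
shifts costs `e`. The potential costs `B`, enlarged to `e B` to give one common factor. -/
theorem expWeightedNorm_schrodinger_le {d : ℕ} {V : Lattice d → ℝ} {B : ℝ}
    (hB : ∀ n, |V n| ≤ B) (k : Lattice d) (v : Lattice d → ℂ) :
    expWeightedNorm k (schrodinger V v) ≤
      ENNReal.ofReal (Real.exp 1 * (2 * d + B)) * expWeightedNorm k v := by
  have hB0 : 0 ≤ B := (abs_nonneg _).trans (hB 0)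
  have he : (1 : ℝ) ≤ Real.exp 1 := Real.one_le_exp zero_le_one
  have key : expWeightedNorm k (schrodinger V v) ≤
      ∑ i : Fin d, (expWeightedNorm k (fun n => v (n + unitVec i)) +
        expWeightedNorm k (fun n => v (n + -unitVec i))) +
        ENNReal.ofReal B * expWeightedNorm k v := by
    simp only [expWeightedNorm]
    simp_rw [← ENNReal.tsum_mul_left, ← ENNReal.tsum_add]
    rw [← Summable.tsum_finsetSum fun _ _ => ENNReal.summable, ← ENNReal.tsum_add]
    refine ENNReal.tsum_le_tsum fun n => ?_
    calc ENNReal.ofReal (Real.exp ‖n - k‖) * ‖schrodinger V v n‖ₑ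
        ≤ ENNReal.ofReal (Real.exp ‖n - k‖) *
          (∑ i : Fin d, (‖v (n + unitVec i)‖ₑ + ‖v (n + -unitVec i)‖ₑ) +
            ENNReal.ofReal B * ‖v n‖ₑ) := by
          gcongr
          rw [schrodinger]
          refine (enorm_add_le _ _).trans (add_le_add ?_ ?_)
          · refine (enorm_sum_le _ _).trans (Finset.sum_le_sum fun i _ => ?_)
            rw [sub_eq_add_neg]
            exact enorm_add_le _ _
          · rw [enorm_mul]
            gcongr
            rw [← ofReal_norm, Complex.norm_real]
            exact ENNReal.ofReal_le_ofReal (hB n)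
      _ = _ := by
          rw [mul_add, Finset.mul_sum]
          simp_rw [mul_add]
          ring
  refine key.trans ?_
  calc _ ≤ ∑ i : Fin d, (ENNReal.ofReal (Real.exp 1) * expWeightedNorm k v +
          ENNReal.ofReal (Real.exp 1) * expWeightedNorm k v) +
          ENNReal.ofReal (Real.exp 1 * B) * expWeightedNorm k v := by
        gcongr with i
        · exact expWeightedNorm_shift_le _ _ (norm_unitVec_le i) _
        · exact expWeightedNorm_shift_le _ _ (by rw [norm_neg]; exact norm_unitVec_le i) _
        · nlinarith
    _ = _ := by
        rw [Finset.sum_const, Finset.card_univ, Fintype.card_fin, nsmul_eq_mul, mul_add (Real.exp 1),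
          ENNReal.ofReal_add (by positivity) (by positivity), add_mul,
          ENNReal.ofReal_mul (by positivity : 0 ≤ Real.exp 1),
          ENNReal.ofReal_mul (by positivity : 0 ≤ Real.exp 1),
          ENNReal.ofReal_mul (by positivity : (0 : ℝ) ≤ 2)]
        simp
        ring

theorem delta_apply {d : ℕ} (k n : Lattice d) : delta k n = if n = k then 1 else 0 := by
  rw [delta, lp.single_apply]
  simp [Pi.single_apply]

theorem expWeightedNorm_delta {d : ℕ} (k : Lattice d) : expWeightedNorm k (delta k) = 1 := by
  rw [expWeightedNorm, tsum_eq_single k]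
  · simp [delta_apply]
  · intro n hn
    simp [delta_apply, hn]

theorem pow_succ_schrodingerOp_apply {d : ℕ} (V : Lattice d → ℝ) (hV : IsBoundedPotential V)
    (k : Lattice d) (m : ℕ) :
    (((schrodingerOp V hV ^ (m + 1)) (delta k) : L2 d) : Lattice d → ℂ) =
      schrodinger V ((schrodingerOp V hV ^ m) (delta k) : L2 d) := by
  ext n
  rw [pow_succ', ← schrodingerOp_apply V hV]
  rfl

theorem expWeightedNorm_pow_schrodingerOp_le {d : ℕ} {V : Lattice d → ℝ}
    (hV : IsBoundedPotential V) {B : ℝ} (hB : ∀ n, |V n| ≤ B) (k : Lattice d) (m : ℕ) :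
    expWeightedNorm k ((schrodingerOp V hV ^ m) (delta k) : L2 d) ≤
      ENNReal.ofReal (Real.exp 1 * (2 * d + B)) ^ m := by
  induction m with
  | zero => simp [expWeightedNorm_delta]
  | succ m ih =>
    rw [pow_succ_schrodingerOp_apply, pow_succ']
    exact (expWeightedNorm_schrodinger_le hB k _).trans (by gcongr)

theorem hasSum_evolution {d : ℕ} (V : Lattice d → ℝ) (hV : IsBoundedPotential V) (k n : Lattice d)
    (t : ℝ) :
    HasSum (fun m : ℕ => (m.factorial : ℂ)⁻¹ * (-(Complex.I * (t : ℂ))) ^ m *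
      ((schrodingerOp V hV ^ m) (delta k) : L2 d) n) (evolution V hV t (delta k) n) := by
  have h := NormedSpace.exp_series_hasSum_exp' (𝕂 := ℂ)
    ((-(Complex.I * (t : ℂ))) • schrodingerOp V hV)
  have h2 := h.mapL ((lp.evalCLM ℂ (fun _ : Lattice d => ℂ) 2 n).comp
    (ContinuousLinearMap.apply ℂ (L2 d) (delta k)))
  refine (congrArg (HasSum · (evolution V hV t (delta k) n)) (funext fun m => ?_)).mp h2
  rw [smul_pow, smul_smul]
  rfl

theorem continuous_evolution {d : ℕ} (V : Lattice d → ℝ) (hV : IsBoundedPotential V)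
    (k n : Lattice d) : Continuous fun t => evolution V hV t (delta k) n := by
  have h1 : Continuous fun t => evolution V hV t (delta k) := by
    unfold evolution
    have h0 : Continuous (NormedSpace.exp : (L2 d →L[ℂ] L2 d) → L2 d →L[ℂ] L2 d) := by
      let _ := NormedAlgebra.restrictScalars ℚ ℂ (L2 d →L[ℂ] L2 d)
      exact NormedSpace.exp_continuous
    fun_prop
  exact (lp.evalCLM ℂ (fun _ : Lattice d => ℂ) 2 n).continuous.comp h1

theorem enorm_exp_coeff (m : ℕ) (t : ℝ) :
    ‖(m.factorial : ℂ)⁻¹ * (-(Complex.I * (t : ℂ))) ^ m‖ₑ =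
      ENNReal.ofReal (|t| ^ m / m.factorial) := by
  rw [← ofReal_norm]
  congr 1
  simp [div_eq_inv_mul]

theorem tsum_ofReal_exp_coeff {D t : ℝ} (hD : 0 ≤ D) :
    ∑' m : ℕ, ENNReal.ofReal (|t| ^ m / m.factorial) * ENNReal.ofReal D ^ m =
      ENNReal.ofReal (Real.exp (D * |t|)) := by
  have h : HasSum (fun m : ℕ => (D * |t|) ^ m / m.factorial) (Real.exp (D * |t|)) := by
    rw [Real.exp_eq_exp_ℝ]
    exact NormedSpace.expSeries_div_hasSum_exp _
  rw [← h.tsum_eq, ENNReal.ofReal_tsum_of_nonneg (fun m => by positivity) h.summable]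
  refine tsum_congr fun m => ?_
  rw [← ENNReal.ofReal_pow hD, ← ENNReal.ofReal_mul (by positivity)]
  congr 1
  ring

/-- The absolute values are taken inside the exponential series, so this one bound yields both the
decay of the evolution and the absolute convergence needed to exchange the sums over sites and
powers. -/
theorem tsum_tsum_expWeighted_le {d : ℕ} {V : Lattice d → ℝ} (hV : IsBoundedPotential V) {B : ℝ}
    (hB : ∀ n, |V n| ≤ B) (k : Lattice d) (t : ℝ) :
    ∑' n, ∑' m : ℕ, ENNReal.ofReal (Real.exp ‖n - k‖) *
      ‖(m.factorial : ℂ)⁻¹ * (-(Complex.I * (t : ℂ))) ^ m *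
        ((schrodingerOp V hV ^ m) (delta k) : L2 d) n‖ₑ ≤
      ENNReal.ofReal (Real.exp (Real.exp 1 * (2 * d + B) * |t|)) := by
  have hB0 : 0 ≤ B := (abs_nonneg _).trans (hB 0)
  rw [← tsum_ofReal_exp_coeff (by positivity), ENNReal.tsum_comm]
  refine ENNReal.tsum_le_tsum fun m => ?_
  refine le_trans (le_of_eq ?_)
    (mul_le_mul_right (expWeightedNorm_pow_schrodingerOp_le hV hB k m) _)
  rw [expWeightedNorm, ← ENNReal.tsum_mul_left]
  refine tsum_congr fun n => ?_
  rw [enorm_mul, enorm_exp_coeff]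
  ring

theorem expWeightedNorm_evolution_le {d : ℕ} {V : Lattice d → ℝ} (hV : IsBoundedPotential V) {B : ℝ}
    (hB : ∀ n, |V n| ≤ B) (k : Lattice d) (t : ℝ) :
    expWeightedNorm k (evolution V hV t (delta k)) ≤
      ENNReal.ofReal (Real.exp (Real.exp 1 * (2 * d + B) * |t|)) := by
  refine le_trans (ENNReal.tsum_le_tsum fun n => ?_) (tsum_tsum_expWeighted_le hV hB k t)
  rw [ENNReal.tsum_mul_left, ← (hasSum_evolution V hV k n t).tsum_eq]
  gcongr
  exact enorm_tsum_le_tsum_enorm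

theorem tsum_enorm_le_expWeightedNorm {d : ℕ} (k : Lattice d) (v : Lattice d → ℂ) :
    ∑' n, ‖v n‖ₑ ≤ expWeightedNorm k v := by
  refine ENNReal.tsum_le_tsum fun n => ?_
  refine le_mul_of_one_le_left zero_le ?_
  rw [ENNReal.one_le_ofReal]
  exact Real.one_le_exp (norm_nonneg _)

theorem summable_norm_of_expWeightedNorm {d : ℕ} {k : Lattice d} {v : Lattice d → ℂ}
    (h : expWeightedNorm k v ≠ ∞) : Summable fun n => ‖v n‖ := by
  have := ENNReal.summable_toReal (ne_top_of_le_ne_top h (tsum_enorm_le_expWeightedNorm k v))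
  simpa using this

/-! ### Pairing the evolution with bounded generalized eigenfunctions. -/

/-- Summation by parts for the difference expression. -/
theorem tsum_mul_schrodinger {d : ℕ} {V : Lattice d → ℝ} (hV : IsBoundedPotential V)
    {ψ v : Lattice d → ℂ} {M : ℝ} (hψ : ∀ n, ‖ψ n‖ ≤ M) (hv : Summable fun n => ‖v n‖) :
    ∑' n, ψ n * schrodinger V v n = ∑' n, schrodinger V ψ n * v n := by
  have hs : ∀ j l : Lattice d, Summable fun n => ψ (n + j) * v (n + l) := fun j l => by
    refine Summable.of_norm_bounded
      ((hv.comp_injective (add_left_injective l)).mul_left M) fun n => ?_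
    rw [norm_mul]
    exact mul_le_mul_of_nonneg_right (hψ _) (norm_nonneg _)
  have hVs : Summable fun n => ψ n * ((V n : ℂ) * v n) := by
    obtain ⟨B, hB⟩ := hV
    refine Summable.of_norm_bounded (hv.mul_left (M * B)) fun n => ?_
    rw [norm_mul, norm_mul, Complex.norm_real, ← mul_assoc]
    have := (norm_nonneg _).trans (hψ n)
    gcongr
    · exact hψ n
    · exact hB n
  have hshift : ∀ j : Lattice d, ∑' n, ψ n * v (n + j) = ∑' n, ψ (n + -j) * v n := fun j => by
    rw [← (Equiv.addRight j).tsum_eq fun n => ψ (n + -j) * v n]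
    simp
  -- The shifts by `0` put every translated product in the form covered by `hs`.
  have e1 : ∀ n, ψ n * schrodinger V v n = ∑ i : Fin d, (ψ (n + 0) * v (n + unitVec i) +
      ψ (n + 0) * v (n + -unitVec i)) + ψ n * ((V n : ℂ) * v n) := fun n => by
    simp only [schrodinger, mul_add, Finset.mul_sum, add_zero, sub_eq_add_neg]
  have e2 : ∀ n, schrodinger V ψ n * v n = ∑ i : Fin d, (ψ (n + unitVec i) * v (n + 0) +
      ψ (n + -unitVec i) * v (n + 0)) + ψ n * ((V n : ℂ) * v n) := fun n => by
    simp only [schrodinger, add_mul, Finset.sum_mul, add_zero, sub_eq_add_neg]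
    ring
  simp_rw [e1, e2]
  rw [Summable.tsum_add (summable_sum fun i _ => (hs _ _).add (hs _ _)) hVs,
    Summable.tsum_add (summable_sum fun i _ => (hs _ _).add (hs _ _)) hVs,
    Summable.tsum_finsetSum fun i _ => (hs _ _).add (hs _ _),
    Summable.tsum_finsetSum fun i _ => (hs _ _).add (hs _ _)]
  congr 1
  refine Finset.sum_congr rfl fun i _ => ?_
  rw [(hs _ _).tsum_add (hs _ _), (hs _ _).tsum_add (hs _ _)]
  simp only [add_zero]
  rw [hshift, hshift, neg_neg, add_comm]

theorem tsum_mul_pow_schrodingerOp {d : ℕ} {V : Lattice d → ℝ} (hV : IsBoundedPotential V)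
    {ψ : Lattice d → ℂ} {M : ℝ} (hψ : ∀ n, ‖ψ n‖ ≤ M) {E : ℂ}
    (hE : IsGeneralizedEigenfunction V E ψ) (k : Lattice d) (m : ℕ) :
    ∑' n, ψ n * ((schrodingerOp V hV ^ m) (delta k) : L2 d) n = E ^ m * ψ k := by
  obtain ⟨B, hB⟩ := id hV
  induction m with
  | zero =>
    rw [tsum_eq_single k]
    · simp [delta_apply]
    · intro n hn
      simp [delta_apply, hn]
  | succ m ih =>
    rw [pow_succ_schrodingerOp_apply, tsum_mul_schrodinger hV hψ
      (summable_norm_of_expWeightedNorm (k := k) (ne_top_of_le_ne_top (by finiteness)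
        (expWeightedNorm_pow_schrodingerOp_le hV hB k m)))]
    simp_rw [hE _, mul_assoc]
    rw [tsum_mul_left, ih]
    ring

/-- A bounded generalized eigenfunction evolves by a phase when it is paired with `e^{-itH} δ_k`. -/
theorem tsum_mul_evolution {d : ℕ} {V : Lattice d → ℝ} (hV : IsBoundedPotential V)
    {ψ : Lattice d → ℂ} {M : ℝ} (hψ : ∀ n, ‖ψ n‖ ≤ M) {E : ℂ}
    (hE : IsGeneralizedEigenfunction V E ψ) (k : Lattice d) (t : ℝ) :
    ∑' n, ψ n * evolution V hV t (delta k) n = Complex.exp (-(Complex.I * t) * E) * ψ k := by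
  obtain ⟨B, hB⟩ := id hV
  set F : Lattice d → ℕ → ℂ := fun n m => ψ n * ((m.factorial : ℂ)⁻¹ *
    (-(Complex.I * (t : ℂ))) ^ m * ((schrodingerOp V hV ^ m) (delta k) : L2 d) n) with hF
  -- The weight `e^{|n - k|}` is at least `1`, so the weighted bound gives absolute summability on
  -- sites times powers.
  have hsum : Summable (Function.uncurry F) := by
    refine Summable.of_enorm ?_
    change ∑' p : Lattice d × ℕ, ‖F p.1 p.2‖ₑ ≠ ∞
    rw [ENNReal.tsum_prod (f := fun n m => ‖F n m‖ₑ)]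
    refine ne_top_of_le_ne_top (b := ENNReal.ofReal M *
      ENNReal.ofReal (Real.exp (Real.exp 1 * (2 * d + B) * |t|))) (by finiteness) ?_
    refine le_trans ?_ (mul_le_mul_right (tsum_tsum_expWeighted_le hV hB k t) _)
    simp_rw [← ENNReal.tsum_mul_left]
    refine ENNReal.tsum_le_tsum fun n => ENNReal.tsum_le_tsum fun m => ?_
    rw [hF, enorm_mul]
    gcongr
    · rw [← ofReal_norm]
      exact ENNReal.ofReal_le_ofReal (hψ n)
    · refine le_mul_of_one_le_left zero_le ?_
      rw [ENNReal.one_le_ofReal]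
      exact Real.one_le_exp (norm_nonneg _)
  have h1 : ∀ n, ψ n * evolution V hV t (delta k) n = ∑' m, F n m := fun n => by
    rw [hF, tsum_mul_left, (hasSum_evolution V hV k n t).tsum_eq]
  simp_rw [h1]
  rw [← hsum.tsum_comm]
  have h2 : ∀ m, ∑' n, F n m = (-(Complex.I * t) * E) ^ m / m.factorial * ψ k := fun m => by
    have : ∀ n, F n m = ((m.factorial : ℂ)⁻¹ * (-(Complex.I * (t : ℂ))) ^ m) *
        (ψ n * ((schrodingerOp V hV ^ m) (delta k) : L2 d) n) := fun n => by
      rw [hF]; ring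
    simp_rw [this]
    rw [tsum_mul_left, tsum_mul_pow_schrodingerOp hV hψ hE]
    ring
  simp_rw [h2]
  rw [tsum_mul_right, Complex.exp_eq_exp_ℂ, (NormedSpace.expSeries_div_hasSum_exp _).tsum_eq]

/-! ### Truncated Fourier transforms averaged over a Gaussian in energy. -/

/-- The Fourier transform of `f` restricted to the time interval `(0, T]`. -/
def truncatedFourier (T : ℝ) (f : ℝ → ℂ) (E : ℝ) : ℂ :=
  ∫ t in Set.Ioc 0 T, Complex.exp (t * E * Complex.I) * f t

theorem norm_exp_mul_I (t E : ℝ) : ‖Complex.exp (t * E * Complex.I)‖ = 1 := by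
  rw [← Complex.ofReal_mul, Complex.norm_exp_ofReal_mul_I]

theorem integral_exp_sub_gaussianReal (t s : ℝ) :
    ∫ E, Complex.exp (t * E * Complex.I) * (starRingEnd ℂ) (Complex.exp (s * E * Complex.I))
      ∂(gaussianReal 0 1) = (Real.exp (-(1 / 2) * (t - s) ^ 2) : ℝ) := by
  have h := charFun_gaussianReal (μ := 0) (v := 1) (t - s)
  rw [charFun_apply_real] at h
  calc _ = ∫ E, Complex.exp ((t - s : ℝ) * E * Complex.I) ∂(gaussianReal 0 1) := by
        refine integral_congr_ae (Filter.Eventually.of_forall fun E => ?_)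
        simp only
        rw [← Complex.exp_conj, ← Complex.exp_add]
        congr 1
        simp
        ring
    _ = _ := by
        rw [h]
        push_cast
        congr 1
        simp
        ring

/-- One half of a Schur test. Enlarging the inner integral to the whole line gives the mass `√(2π)`
of the kernel, independently of the time interval. -/
theorem lintegral_lintegral_gaussian_le (μ : Measure ℝ) [SFinite μ] (hμ : μ ≤ volume)
    {f : ℝ → ℝ} (hf : ∀ t, 0 ≤ f t) :
    ∫⁻ t, ∫⁻ s, ENNReal.ofReal (f t * Real.exp (-(1 / 2) * (t - s) ^ 2)) ∂μ ∂μ ≤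
      ENNReal.ofReal (Real.sqrt (2 * Real.pi)) * ∫⁻ t, ENNReal.ofReal (f t) ∂μ := by
  rw [← lintegral_const_mul' _ _ ENNReal.ofReal_ne_top]
  refine lintegral_mono fun t => ?_
  simp_rw [ENNReal.ofReal_mul (hf t)]
  rw [lintegral_const_mul' _ _ ENNReal.ofReal_ne_top, mul_comm]
  gcongr
  have hint : Integrable fun s : ℝ => Real.exp (-(1 / 2) * (t - s) ^ 2) :=
    (integrable_exp_neg_mul_sq (b := 1 / 2) (by norm_num)).comp_sub_left t
  calc _ ≤ ∫⁻ s, ENNReal.ofReal (Real.exp (-(1 / 2) * (t - s) ^ 2)) := lintegral_mono' hμ le_rfl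
    _ = ENNReal.ofReal (∫ s, Real.exp (-(1 / 2) * (t - s) ^ 2)) :=
        (ofReal_integral_eq_lintegral_ofReal hint
          (Filter.Eventually.of_forall fun s => (Real.exp_pos _).le)).symm
    _ = _ := by
        rw [integral_sub_left_eq_self (fun x : ℝ => Real.exp (-(1 / 2) * x ^ 2)) volume t,
          integral_gaussian]
        congr 2
        ring

/-- A Bessel inequality for the truncated Fourier transform, with a Gaussian weight in energy. -/
theorem lintegral_truncatedFourier_le {f : ℝ → ℂ} (hf : Continuous f) (T : ℝ) :
    ∫⁻ E, ‖truncatedFourier T f E‖ₑ ^ 2 ∂(gaussianReal 0 1) ≤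
      ENNReal.ofReal (Real.sqrt (2 * Real.pi)) * ∫⁻ t in Set.Ioc 0 T, ‖f t‖ₑ ^ 2 := by
  set μ : Measure ℝ := volume.restrict (Set.Ioc 0 T) with hμ
  set γ : Measure ℝ := gaussianReal 0 1
  have hfi : Integrable f μ := (hf.integrableOn_Icc).mono_set Set.Ioc_subset_Icc_self
  set F : ℝ → ℝ × ℝ → ℂ := fun E p => (Complex.exp (p.1 * E * Complex.I) * f p.1) *
    (starRingEnd ℂ) (Complex.exp (p.2 * E * Complex.I) * f p.2) with hF
  have hFi : Integrable (Function.uncurry F) (γ.prod (μ.prod μ)) := by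
    have h1 : Integrable (fun p : ℝ × ℝ × ℝ => ‖f p.2.1‖ * ‖f p.2.2‖) (γ.prod (μ.prod μ)) :=
      (hfi.norm.mul_prod hfi.norm).comp_snd γ
    refine h1.mono (Continuous.aestronglyMeasurable ?_) (Filter.Eventually.of_forall fun p => ?_)
    · simp only [hF, Function.uncurry_def]
      fun_prop
    · simp only [hF, Function.uncurry_def]
      rw [norm_mul, RCLike.norm_conj, norm_mul, norm_mul, norm_exp_mul_I, norm_exp_mul_I,
        one_mul, one_mul, norm_mul, norm_norm, norm_norm]
  have hg : ∀ E, ((‖truncatedFourier T f E‖ ^ 2 : ℝ) : ℂ) = ∫ p, F E p ∂(μ.prod μ) := fun E => by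
    rw [hF, integral_prod_mul (fun t : ℝ => Complex.exp (t * E * Complex.I) * f t)
      (fun t : ℝ => (starRingEnd ℂ) (Complex.exp (t * E * Complex.I) * f t)), integral_conj]
    rw [Complex.ofReal_pow, ← Complex.mul_conj']
    rfl
  have hgi : Integrable (fun E => ‖truncatedFourier T f E‖ ^ 2) γ := by
    have := hFi.integral_prod_left.re
    refine this.congr (Filter.Eventually.of_forall fun E => ?_)
    change RCLike.re (∫ p, F E p ∂(μ.prod μ)) = _
    rw [← hg]
    exact Complex.ofReal_re _
  have h1 : ∫⁻ E, ‖truncatedFourier T f E‖ₑ ^ 2 ∂γ =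
      ‖∫ p : ℝ × ℝ, f p.1 * (starRingEnd ℂ) (f p.2) *
        (Real.exp (-(1 / 2) * (p.1 - p.2) ^ 2) : ℝ) ∂(μ.prod μ)‖ₑ := by
    calc _ = ∫⁻ E, ENNReal.ofReal (‖truncatedFourier T f E‖ ^ 2) ∂γ := by
          simp_rw [ENNReal.ofReal_pow (norm_nonneg _), ofReal_norm]
      _ = ENNReal.ofReal (∫ E, ‖truncatedFourier T f E‖ ^ 2 ∂γ) :=
          (ofReal_integral_eq_lintegral_ofReal hgi
            (Filter.Eventually.of_forall fun E => by positivity)).symm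
      _ = ‖∫ E, ((‖truncatedFourier T f E‖ ^ 2 : ℝ) : ℂ) ∂γ‖ₑ := by
          rw [integral_complex_ofReal, ← ofReal_norm, Complex.norm_real, Real.norm_of_nonneg]
          exact integral_nonneg fun E => by positivity
      _ = _ := by
          simp_rw [hg]
          -- After Fubini the energy integral is the characteristic function of the Gaussian at `t -
          -- s`, which is an integrable kernel in time.
          rw [integral_integral_swap hFi]
          congr 1
          refine integral_congr_ae (Filter.Eventually.of_forall fun p => ?_)
          simp only [hF]
          rw [← integral_exp_sub_gaussianReal, ← integral_const_mul]
          refine integral_congr_ae (Filter.Eventually.of_forall fun E => ?_)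
          simp only [map_mul]
          ring
  set K : ℝ × ℝ → ℝ := fun p => Real.exp (-(1 / 2) * (p.1 - p.2) ^ 2) with hK
  have hm1 : Measurable fun p : ℝ × ℝ => ENNReal.ofReal (‖f p.1‖ ^ 2 / 2 * K p) := by
    refine (Continuous.measurable ?_).ennreal_ofReal
    fun_prop
  have hm2 : Measurable fun p : ℝ × ℝ => ENNReal.ofReal (‖f p.2‖ ^ 2 / 2 * K p) := by
    refine (Continuous.measurable ?_).ennreal_ofReal
    fun_prop
  have hb := lintegral_lintegral_gaussian_le μ Measure.restrict_le_self
    (f := fun t => ‖f t‖ ^ 2 / 2) fun t => by positivity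
  rw [h1]
  calc _ ≤ ∫⁻ p : ℝ × ℝ, ‖f p.1 * (starRingEnd ℂ) (f p.2) * (K p : ℂ)‖ₑ ∂(μ.prod μ) :=
        enorm_integral_le_lintegral_enorm _
    -- The inequality `|f(t) f(s)| ≤ (|f(t)|² + |f(s)|²) / 2` reduces the double integral to two
    -- Schur bounds.
    _ ≤ ∫⁻ p : ℝ × ℝ, (ENNReal.ofReal (‖f p.1‖ ^ 2 / 2 * K p) +
          ENNReal.ofReal (‖f p.2‖ ^ 2 / 2 * K p)) ∂(μ.prod μ) := by
        refine lintegral_mono fun p => ?_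
        have hKp : 0 ≤ K p := (Real.exp_pos _).le
        rw [← ENNReal.ofReal_add (by positivity) (by positivity), ← ofReal_norm, norm_mul,
          norm_mul, RCLike.norm_conj, Complex.norm_real, Real.norm_of_nonneg hKp]
        refine ENNReal.ofReal_le_ofReal ?_
        nlinarith [mul_nonneg (sq_nonneg (‖f p.1‖ - ‖f p.2‖)) hKp]
    _ = ∫⁻ t, ∫⁻ s, ENNReal.ofReal (‖f t‖ ^ 2 / 2 * K (t, s)) ∂μ ∂μ +
          ∫⁻ t, ∫⁻ s, ENNReal.ofReal (‖f t‖ ^ 2 / 2 * K (s, t)) ∂μ ∂μ := by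
        rw [lintegral_add_left hm1, lintegral_prod _ hm1.aemeasurable,
          lintegral_prod_symm _ hm2.aemeasurable]
    _ ≤ ENNReal.ofReal (Real.sqrt (2 * Real.pi)) * ∫⁻ t, ENNReal.ofReal (‖f t‖ ^ 2 / 2) ∂μ +
          ENNReal.ofReal (Real.sqrt (2 * Real.pi)) * ∫⁻ t, ENNReal.ofReal (‖f t‖ ^ 2 / 2) ∂μ := by
        refine add_le_add hb (le_trans (le_of_eq ?_) hb)
        simp_rw [hK, fun t s : ℝ => show (s - t) ^ 2 = (t - s) ^ 2 by ring]
    _ = _ := by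
        rw [← mul_add, ← lintegral_add_left (by fun_prop)]
        congr 2
        ext t
        rw [← ENNReal.ofReal_add (by positivity) (by positivity), add_halves,
          ENNReal.ofReal_pow (norm_nonneg _), ofReal_norm]

theorem measurable_truncatedFourier {f : ℝ → ℂ} (hf : Continuous f) (T : ℝ) :
    Measurable (truncatedFourier T f) := by
  refine StronglyMeasurable.measurable ?_
  refine StronglyMeasurable.integral_prod_right'
    (f := fun p : ℝ × ℝ => Complex.exp (p.2 * p.1 * Complex.I) * f p.2) ?_
  refine Continuous.stronglyMeasurable ?_
  fun_prop

theorem enorm_truncatedFourier_le (f : ℝ → ℂ) (T E : ℝ) :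
    ‖truncatedFourier T f E‖ₑ ≤ ∫⁻ t in Set.Ioc 0 T, ‖f t‖ₑ := by
  refine (enorm_integral_le_lintegral_enorm _).trans (le_of_eq (lintegral_congr fun t => ?_))
  rw [enorm_mul, ← ofReal_norm (Complex.exp _), norm_exp_mul_I]
  simp

/-! ### Summability of powers of the weight `⟨n⟩`. -/

theorem one_le_japaneseBracket {d : ℕ} (n : Lattice d) : 1 ≤ japaneseBracket n := by
  rw [japaneseBracket, Real.one_le_sqrt]
  nlinarith [sq_nonneg ‖n‖]

theorem japaneseBracket_le {d : ℕ} (n : Lattice d) : japaneseBracket n ≤ 1 + ‖n‖ :=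
  Real.sqrt_le_iff.2 ⟨by positivity, by nlinarith [norm_nonneg n]⟩

theorem norm_le_japaneseBracket {d : ℕ} (n : Lattice d) : ‖n‖ ≤ japaneseBracket n :=
  Real.le_sqrt_of_sq_le (by linarith)

/-- `ℤ^d` embeds isometrically, for the maximum norms, in the `ℤ`-span of the standard basis of
`ℝ^d`, a lattice of rank `d`. -/
theorem summable_norm_rpow_lattice {d : ℕ} {r : ℝ} (hr : r < -d) :
    Summable fun n : Lattice d => ‖n‖ ^ r := by
  set L : Submodule ℤ (Fin d → ℝ) := Submodule.span ℤ (Set.range (Pi.basisFun ℝ (Fin d))) with hL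
  have hrank : Module.finrank ℤ L = d := by
    rw [ZLattice.rank ℝ L]
    simp
  have hmem : ∀ n : Lattice d, (fun i => (n i : ℝ)) ∈ L := fun n => by
    rw [hL, Module.Basis.mem_span_iff_repr_mem]
    intro i
    exact ⟨n i, by simp⟩
  have hinj : Function.Injective fun n : Lattice d => (⟨_, hmem n⟩ : L) := fun n m h => by
    funext i
    have h' : (n i : ℝ) = m i := congrFun (Subtype.ext_iff.1 h) i
    exact_mod_cast h'
  have h := (ZLattice.summable_norm_rpow L r (by rwa [hrank])).comp_injective hinj
  refine h.congr fun n => ?_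
  change ‖(fun i => (n i : ℝ))‖ ^ r = ‖n‖ ^ r
  congr 1

theorem summable_japaneseBracket_rpow_neg {d : ℕ} {s : ℝ} (hs : (d : ℝ) < s) :
    Summable fun n : Lattice d => japaneseBracket n ^ (-s) := by
  have hs0 : 0 < s := (Nat.cast_nonneg d).trans_lt hs
  refine Summable.of_norm_bounded_eventually
    (summable_norm_rpow_lattice (d := d) (r := -s) (by linarith)) ?_
  -- The origin is left out because `0 ^ (-s) = 0` by convention, so the comparison fails there.
  filter_upwards [(Set.finite_singleton (0 : Lattice d)).compl_mem_cofinite] with n hn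
  have hn0 : 0 < ‖n‖ := norm_pos_iff.2 hn
  rw [Real.norm_of_nonneg (Real.rpow_nonneg (zero_le_one.trans (one_le_japaneseBracket n)) _)]
  exact Real.rpow_le_rpow_of_nonpos hn0 (norm_le_japaneseBracket n) (by linarith)

/-! ### Lower bounds for transport by time and energy averages. -/

theorem norm_evolution_delta {d : ℕ} (V : Lattice d → ℝ) (hV : IsBoundedPotential V)
    (k : Lattice d) (t : ℝ) : ‖evolution V hV t (delta k)‖ = 1 := by
  have hu : evolution V hV t ∈ unitary (L2 d →L[ℂ] L2 d) := by
    let _ := NormedAlgebra.restrictScalars ℚ ℂ (L2 d →L[ℂ] L2 d)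
    refine NormedSpace.exp_mem_unitary_of_mem_skewAdjoint ?_
    rw [skewAdjoint.mem_iff, star_smul, (isSelfAdjoint_schrodingerOp V hV).star_eq]
    simp
  rw [ContinuousLinearMap.norm_map_of_mem_unitary hu, delta]
  simp [lp.norm_single]

theorem expectation_eq {d : ℕ} {φ : Lattice d → ℝ} (hφ : ∀ n, 0 ≤ φ n) (u : L2 d) :
    expectation φ u = ∑' n, ENNReal.ofReal (φ n) * ‖u n‖ₑ ^ 2 := by
  refine tsum_congr fun n => ?_
  rw [ENNReal.ofReal_mul (hφ n), ENNReal.ofReal_pow (norm_nonneg _), ofReal_norm]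

theorem one_le_expectation {d : ℕ} {φ : Lattice d → ℝ} (hφ : ∀ n, 1 ≤ φ n) {u : L2 d}
    (hu : ‖u‖ = 1) : 1 ≤ expectation φ u := by
  have hs : Summable fun n => ‖u n‖ ^ 2 := (memℓp_two_iff _).1 (lp.memℓp u)
  have h : (1 : ℝ≥0∞) = ∑' n, ENNReal.ofReal (‖u n‖ ^ 2) := by
    rw [← ENNReal.ofReal_tsum_of_nonneg (fun n => by positivity) hs, ← norm_sq_eq_tsum, hu]
    simp
  rw [h]
  refine ENNReal.tsum_le_tsum fun n => ENNReal.ofReal_le_ofReal ?_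
  exact le_mul_of_one_le_left (by positivity) (hφ n)

/-- The Abelian time average dominates the Cesàro average over `(0, T]`. -/
theorem lintegral_expectation_le_transport {d : ℕ} (V : Lattice d → ℝ) (hV : IsBoundedPotential V)
    (φ : Lattice d → ℝ) (k : Lattice d) {T : ℝ} (hT : 0 < T) :
    ENNReal.ofReal (1 / T) * (ENNReal.ofReal (Real.exp (-1)) *
      ∫⁻ t in Set.Ioc 0 T, expectation φ (evolution V hV t (delta k))) ≤
      transport V hV φ k T := by
  rw [transport, ← lintegral_const_mul' _ _ ENNReal.ofReal_ne_top]
  refine mul_le_mul_right ?_ _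
  refine le_trans (setLIntegral_mono' measurableSet_Ioc fun t ht => ?_)
    (lintegral_mono_set Set.Ioc_subset_Ioi_self)
  gcongr
  rw [neg_div, neg_le_neg_iff, div_le_one hT]
  exact ht.2

/-- Unitarity keeps the expectation at least `1`, and `e^{-t/T} ≥ e^{-1}` on `(0, T]`. This handles
small `T`, where the ballistic radius is not comparable to `T`. -/
theorem exp_neg_one_le_transport {d : ℕ} (V : Lattice d → ℝ) (hV : IsBoundedPotential V)
    {φ : Lattice d → ℝ} (hφ : ∀ n, 1 ≤ φ n) (k : Lattice d) {T : ℝ} (hT : 0 < T) :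
    ENNReal.ofReal (Real.exp (-1)) ≤ transport V hV φ k T := by
  refine le_trans ?_ (lintegral_expectation_le_transport V hV φ k hT)
  have h : ENNReal.ofReal T ≤
      ∫⁻ t in Set.Ioc 0 T, expectation φ (evolution V hV t (delta k)) := by
    calc ENNReal.ofReal T = ∫⁻ _ in Set.Ioc 0 T, (1 : ℝ≥0∞) := by simp
      _ ≤ _ := lintegral_mono fun t => one_le_expectation hφ (norm_evolution_delta V hV k t)
  calc ENNReal.ofReal (Real.exp (-1)) =
        ENNReal.ofReal (1 / T) * (ENNReal.ofReal (Real.exp (-1)) * ENNReal.ofReal T) := by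
        rw [← ENNReal.ofReal_mul (by positivity), ← ENNReal.ofReal_mul (by positivity)]
        congr 1
        field_simp
    _ ≤ _ := by gcongr

/-- The amplitudes `⟨δ_n, e^{-itH} δ_k⟩` on `(0, T]`, Fourier transformed in time. -/
def energyAmplitude {d : ℕ} (V : Lattice d → ℝ) (hV : IsBoundedPotential V) (k : Lattice d)
    (T E : ℝ) (n : Lattice d) : ℂ :=
  truncatedFourier T (fun t => evolution V hV t (delta k) n) E

/-- Time averages of expectations dominate the energy averages of the Fourier transformed
amplitudes. -/
theorem lintegral_energyAmplitude_le_transport {d : ℕ} (V : Lattice d → ℝ)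
    (hV : IsBoundedPotential V) {φ : Lattice d → ℝ} (hφ : ∀ n, 0 ≤ φ n) (k : Lattice d) {T : ℝ}
    (hT : 0 < T) :
    ENNReal.ofReal (Real.exp (-1) / (T * Real.sqrt (2 * Real.pi))) *
      ∫⁻ E, ∑' n, ENNReal.ofReal (φ n) * ‖energyAmplitude V hV k T E n‖ₑ ^ 2 ∂(gaussianReal 0 1) ≤
      transport V hV φ k T := by
  have hc := continuous_evolution V hV k
  have hpi : 0 < Real.sqrt (2 * Real.pi) := Real.sqrt_pos.2 (by positivity)
  have h : ∫⁻ E, ∑' n, ENNReal.ofReal (φ n) * ‖energyAmplitude V hV k T E n‖ₑ ^ 2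
      ∂(gaussianReal 0 1) ≤ ENNReal.ofReal (Real.sqrt (2 * Real.pi)) *
        ∫⁻ t in Set.Ioc 0 T, expectation φ (evolution V hV t (delta k)) := by
    simp_rw [expectation_eq hφ]
    have hm : ∀ n, Measurable fun E => ENNReal.ofReal (φ n) *
        ‖energyAmplitude V hV k T E n‖ₑ ^ 2 := fun n =>
      ((measurable_truncatedFourier (hc n) T).enorm.pow_const 2).const_mul _
    rw [lintegral_tsum fun n => (hm n).aemeasurable, lintegral_tsum fun n =>
        (((hc n).measurable.enorm.pow_const 2).const_mul _).aemeasurable, ← ENNReal.tsum_mul_left]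
    refine ENNReal.tsum_le_tsum fun n => ?_
    rw [lintegral_const_mul' _ _ ENNReal.ofReal_ne_top,
      lintegral_const_mul' _ _ ENNReal.ofReal_ne_top, mul_left_comm]
    gcongr
    exact lintegral_truncatedFourier_le (hc n) T
  refine le_trans ?_ (lintegral_expectation_le_transport V hV φ k hT)
  calc _ ≤ ENNReal.ofReal (Real.exp (-1) / (T * Real.sqrt (2 * Real.pi))) *
        (ENNReal.ofReal (Real.sqrt (2 * Real.pi)) *
          ∫⁻ t in Set.Ioc 0 T, expectation φ (evolution V hV t (delta k))) := by gcongr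
    _ = _ := by
      rw [← mul_assoc, ← mul_assoc, ← ENNReal.ofReal_mul (by positivity),
        ← ENNReal.ofReal_mul (by positivity)]
      congr 2
      field_simp

/-! ### Energy amplitudes in the presence of a bounded eigenfunction. -/

theorem lintegral_expWeightedNorm_evolution_le {d : ℕ} {V : Lattice d → ℝ}
    (hV : IsBoundedPotential V) {B : ℝ} (hB : ∀ n, |V n| ≤ B) (k : Lattice d) {T : ℝ}
    (hT : 0 < T) :
    ∫⁻ t in Set.Ioc 0 T, expWeightedNorm k (evolution V hV t (delta k)) ≤
      ENNReal.ofReal (T * Real.exp (Real.exp 1 * (2 * d + B) * T)) := by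
  have hB0 : 0 ≤ B := (abs_nonneg _).trans (hB 0)
  calc _ ≤ ∫⁻ _ in Set.Ioc 0 T, ENNReal.ofReal (Real.exp (Real.exp 1 * (2 * d + B) * T)) := by
        refine setLIntegral_mono' measurableSet_Ioc fun t ht =>
          (expWeightedNorm_evolution_le hV hB k t).trans (ENNReal.ofReal_le_ofReal ?_)
        rw [abs_of_pos ht.1]
        gcongr
        exact ht.2
    _ = _ := by
        rw [setLIntegral_const, Real.volume_Ioc, sub_zero, ENNReal.ofReal_mul hT.le, mul_comm]

theorem expWeightedNorm_energyAmplitude_le {d : ℕ} {V : Lattice d → ℝ}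
    (hV : IsBoundedPotential V) {B : ℝ} (hB : ∀ n, |V n| ≤ B) (k : Lattice d) {T : ℝ}
    (hT : 0 < T) (E : ℝ) :
    expWeightedNorm k (energyAmplitude V hV k T E) ≤
      ENNReal.ofReal (T * Real.exp (Real.exp 1 * (2 * d + B) * T)) := by
  refine le_trans ?_ (lintegral_expWeightedNorm_evolution_le hV hB k hT)
  simp only [expWeightedNorm]
  rw [lintegral_tsum fun n =>
    ((continuous_evolution V hV k n).measurable.enorm.const_mul _).aemeasurable]
  refine ENNReal.tsum_le_tsum fun n => ?_
  rw [lintegral_const_mul' _ _ ENNReal.ofReal_ne_top]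
  gcongr
  exact enorm_truncatedFourier_le _ _ _

/-- At the eigenvalue, `e^{itE}` cancels the phase `e^{-itE}` of the pairing, so the integrand is
the constant `ψ k`. The exponential bound justifies exchanging sum and integral. -/
theorem tsum_mul_energyAmplitude {d : ℕ} {V : Lattice d → ℝ} (hV : IsBoundedPotential V)
    {ψ : Lattice d → ℂ} {M : ℝ} (hψ : ∀ n, ‖ψ n‖ ≤ M) {E : ℝ}
    (hE : IsGeneralizedEigenfunction V E ψ) (k : Lattice d) {T : ℝ} (hT : 0 < T) :
    ∑' n, ψ n * energyAmplitude V hV k T E n = T * ψ k := by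
  obtain ⟨B, hB⟩ := id hV
  have hc := continuous_evolution V hV k
  have hfin : ∑' n, ∫⁻ t in Set.Ioc 0 T,
      ‖ψ n * (Complex.exp (t * E * Complex.I) * evolution V hV t (delta k) n)‖ₑ ≠ ∞ := by
    rw [← lintegral_tsum fun n => (Continuous.measurable (by
      have := hc n
      fun_prop)).enorm.aemeasurable]
    refine ne_top_of_le_ne_top (b := ENNReal.ofReal M *
      ENNReal.ofReal (T * Real.exp (Real.exp 1 * (2 * d + B) * T))) (by finiteness) ?_
    refine le_trans ?_ (mul_le_mul_right (lintegral_expWeightedNorm_evolution_le hV hB k hT) _)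
    rw [← lintegral_const_mul' _ _ ENNReal.ofReal_ne_top]
    refine lintegral_mono fun t => ?_
    refine le_trans ?_ (mul_le_mul_right (tsum_enorm_le_expWeightedNorm k _) _)
    rw [← ENNReal.tsum_mul_left]
    refine ENNReal.tsum_le_tsum fun n => ?_
    rw [enorm_mul, enorm_mul, ← ofReal_norm (Complex.exp _), norm_exp_mul_I, ENNReal.ofReal_one,
      one_mul, ← ofReal_norm (ψ n)]
    gcongr
    exact hψ n
  calc _ = ∑' n, ∫ t in Set.Ioc 0 T,
        ψ n * (Complex.exp (t * E * Complex.I) * evolution V hV t (delta k) n) := by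
        simp_rw [integral_const_mul]
        rfl
    _ = ∫ t in Set.Ioc 0 T, ∑' n,
        ψ n * (Complex.exp (t * E * Complex.I) * evolution V hV t (delta k) n) := by
        refine (integral_tsum (fun n => Continuous.aestronglyMeasurable ?_) hfin).symm
        have := hc n
        fun_prop
    _ = ∫ _ in Set.Ioc 0 T, ψ k := by
        refine integral_congr_ae (Filter.Eventually.of_forall fun t => ?_)
        simp_rw [mul_left_comm (ψ _)]
        rw [tsum_mul_left, tsum_mul_evolution hV hψ hE, ← mul_assoc, ← Complex.exp_add]
        rw [show (t * E * Complex.I + -(Complex.I * t) * E : ℂ) = 0 by ring]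
        simp
    _ = _ := by
        simp [hT.le]

/-- The energies at which there is a bounded generalized eigenfunction that does not vanish at `k`
and is bounded by `N` times its modulus there. -/
def boundedEnergies {d : ℕ} (V : Lattice d → ℝ) (k : Lattice d) (N : ℝ) : Set ℝ :=
  {E | ∃ ψ : Lattice d → ℂ, IsGeneralizedEigenfunction V (E : ℂ) ψ ∧ ψ k ≠ 0 ∧
    ∀ n, ‖ψ n‖ ≤ N * ‖ψ k‖}

theorem le_tsum_enorm_energyAmplitude {d : ℕ} {V : Lattice d → ℝ} (hV : IsBoundedPotential V)
    {k : Lattice d} {N E : ℝ} (hN : 0 ≤ N) (hE : E ∈ boundedEnergies V k N) {T : ℝ}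
    (hT : 0 < T) :
    ENNReal.ofReal T ≤ ENNReal.ofReal N * ∑' n, ‖energyAmplitude V hV k T E n‖ₑ := by
  obtain ⟨ψ, hψ, hk, hb⟩ := hE
  have hk' : ‖ψ k‖ₑ ≠ 0 := by simpa using hk
  have h : ENNReal.ofReal T * ‖ψ k‖ₑ ≤
      (ENNReal.ofReal N * ∑' n, ‖energyAmplitude V hV k T E n‖ₑ) * ‖ψ k‖ₑ := by
    calc ENNReal.ofReal T * ‖ψ k‖ₑ = ‖∑' n, ψ n * energyAmplitude V hV k T E n‖ₑ := by
          rw [tsum_mul_energyAmplitude hV hb hψ k hT, enorm_mul, ← ofReal_norm (T : ℂ),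
            Complex.norm_real, Real.norm_of_nonneg hT.le]
      _ ≤ ∑' n, ‖ψ n * energyAmplitude V hV k T E n‖ₑ := enorm_tsum_le_tsum_enorm
      _ ≤ ∑' n, ENNReal.ofReal (N * ‖ψ k‖) * ‖energyAmplitude V hV k T E n‖ₑ := by
          refine ENNReal.tsum_le_tsum fun n => ?_
          rw [enorm_mul, ← ofReal_norm (ψ n)]
          gcongr
          exact hb n
      _ = _ := by
          rw [ENNReal.tsum_mul_left, ENNReal.ofReal_mul hN, ofReal_norm]
          ring
  exact (ENNReal.mul_le_mul_iff_left hk' enorm_ne_top).1 h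

/-- The sum of the inverse weights over a ball controls weighted `ℓ²` norms from below in the
presence of a generalized eigenfunction. -/
theorem le_tsum_weight_energyAmplitude {d : ℕ} {V : Lattice d → ℝ} (hV : IsBoundedPotential V)
    {B : ℝ} (hB : ∀ n, |V n| ≤ B) {k : Lattice d} {N E : ℝ} (hN : 0 < N)
    (hE : E ∈ boundedEnergies V k N) {T : ℝ} (hT : 0 < T) {φ : Lattice d → ℝ} (hφ : ∀ n, 0 < φ n)
    {R S : ℝ} (hR : Real.exp 1 * (2 * d + B) * T + Real.log (2 * N) ≤ R) (hS : 0 < S)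
    (hRS : ∑' n, (if ‖n - k‖ ≤ R then ENNReal.ofReal (φ n)⁻¹ else 0) ≤ ENNReal.ofReal S) :
    ENNReal.ofReal (T ^ 2 / (4 * N ^ 2 * S)) ≤
      ∑' n, ENNReal.ofReal (φ n) * ‖energyAmplitude V hV k T E n‖ₑ ^ 2 := by
  set g := energyAmplitude V hV k T E with hg
  set Q := ∑' n, ENNReal.ofReal (φ n) * ‖g n‖ₑ ^ 2 with hQ
  -- The parameter of Young's inequality `N x ≤ l φ x² + N² / (4 l φ)`, which replaces
  -- Cauchy–Schwarz and can be summed even if `Q = ∞`. This value makes the second terms sum to at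
  -- most `T/4` over the ball.
  set l := N ^ 2 * S / T with hl
  have hl0 : 0 < l := by positivity
  have hpt : ∀ n, ENNReal.ofReal N * ‖g n‖ₑ ≤
      ENNReal.ofReal l * (ENNReal.ofReal (φ n) * ‖g n‖ₑ ^ 2) +
      ENNReal.ofReal (N ^ 2 / (4 * l)) * (if ‖n - k‖ ≤ R then ENNReal.ofReal (φ n)⁻¹ else 0) +
      ENNReal.ofReal (N * Real.exp (-R)) * (ENNReal.ofReal (Real.exp ‖n - k‖) * ‖g n‖ₑ) := by
    intro n
    split_ifs with h
    · refine le_trans ?_ le_self_add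
      have := hφ n
      rw [← ofReal_norm, ← ENNReal.ofReal_pow (norm_nonneg _), ← ENNReal.ofReal_mul hN.le,
        ← ENNReal.ofReal_mul this.le, ← ENNReal.ofReal_mul hl0.le,
        ← ENNReal.ofReal_mul (by positivity), ← ENNReal.ofReal_add (by positivity) (by positivity)]
      refine ENNReal.ofReal_le_ofReal ?_
      have e : l * (φ n * ‖g n‖ ^ 2) + N ^ 2 / (4 * l) * (φ n)⁻¹ - N * ‖g n‖ =
          (2 * l * φ n * ‖g n‖ - N) ^ 2 / (4 * l * φ n) := by
        field_simp
        ring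
      have : 0 ≤ (2 * l * φ n * ‖g n‖ - N) ^ 2 / (4 * l * φ n) := by positivity
      linarith
    · refine le_trans ?_ le_add_self
      rw [← mul_assoc, ← ENNReal.ofReal_mul (by positivity), mul_assoc, ← Real.exp_add]
      gcongr
      refine le_mul_of_one_le_right hN.le (Real.one_le_exp ?_)
      linarith [not_le.1 h]
  have hsum : ENNReal.ofReal T ≤ ENNReal.ofReal l * Q + ENNReal.ofReal (T / 4) +
      ENNReal.ofReal (T / 2) := by
    refine (le_tsum_enorm_energyAmplitude hV hN.le hE hT).trans ?_
    rw [← ENNReal.tsum_mul_left]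
    refine (ENNReal.tsum_le_tsum hpt).trans ?_
    rw [ENNReal.tsum_add, ENNReal.tsum_add, ENNReal.tsum_mul_left, ENNReal.tsum_mul_left,
      ENNReal.tsum_mul_left]
    gcongr
    · refine (mul_le_mul_right hRS _).trans ?_
      rw [← ENNReal.ofReal_mul (by positivity)]
      refine ENNReal.ofReal_le_ofReal (le_of_eq ?_)
      rw [hl]
      field_simp
    · refine (mul_le_mul_right (expWeightedNorm_energyAmplitude_le hV hB k hT E) _).trans ?_
      rw [← ENNReal.ofReal_mul (by positivity)]
      refine ENNReal.ofReal_le_ofReal ?_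
      -- The term `log (2 N)` in the radius is what reduces the tail outside the ball to `T/2`. Then
      -- `T/4` is left for `l * Q`.
      have h1 : Real.exp (-R) * Real.exp (Real.exp 1 * (2 * d + B) * T) ≤ (2 * N)⁻¹ := by
        rw [← Real.exp_add, ← Real.exp_log (show 0 < (2 * N)⁻¹ by positivity), Real.log_inv,
          Real.exp_le_exp]
        linarith
      calc _ = N * T * (Real.exp (-R) * Real.exp (Real.exp 1 * (2 * d + B) * T)) := by ring
        _ ≤ N * T * (2 * N)⁻¹ := by gcongr
        _ = T / 2 := by field_simp
  have h4 : ENNReal.ofReal (T / 4) ≤ ENNReal.ofReal l * Q := by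
    rw [add_assoc, ← ENNReal.ofReal_add (by positivity) (by positivity),
      show T = T / 4 + (T / 4 + T / 2) by ring, ENNReal.ofReal_add (by positivity) (by positivity),
      show (T / 4 + (T / 4 + T / 2)) / 4 = T / 4 by ring,
      show (T / 4 + (T / 4 + T / 2)) / 2 = T / 2 by ring] at hsum
    exact (ENNReal.add_le_add_iff_right ENNReal.ofReal_ne_top).1 hsum
  refine (ENNReal.mul_le_mul_iff_right (a := ENNReal.ofReal l) (by simpa using hl0)
    ENNReal.ofReal_ne_top).1 (le_trans (le_of_eq ?_) h4)
  rw [← ENNReal.ofReal_mul hl0.le, hl]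
  congr 1
  field_simp

/-- A set of energies of positive measure with bounded generalized eigenfunctions forces linear
growth of transport functions, relative to the sum of the inverse weights over the ball that
`e^{-itH} δ_k` can reach up to time `T`. -/
theorem exists_le_transport {d : ℕ} {V : Lattice d → ℝ} (hV : IsBoundedPotential V) {k : Lattice d}
    {N : ℝ} (hN : 0 < N) (hvol : volume (boundedEnergies V k N) ≠ 0) :
    ∃ c a b : ℝ, 0 < c ∧ 0 ≤ a ∧ 0 ≤ b ∧ ∀ T : ℝ, 0 < T → ∀ φ : Lattice d → ℝ, (∀ n, 0 < φ n) →
      ∀ S : ℝ, 0 < S →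
      ∑' n, (if ‖n - k‖ ≤ a * T + b then ENNReal.ofReal (φ n)⁻¹ else 0) ≤ ENNReal.ofReal S →
      ENNReal.ofReal (c * T / S) ≤ transport V hV φ k T := by
  obtain ⟨B, hB⟩ := id hV
  have hB0 : 0 ≤ B := (abs_nonneg _).trans (hB 0)
  set γ : Measure ℝ := gaussianReal 0 1
  have hpi : 0 < Real.sqrt (2 * Real.pi) := Real.sqrt_pos.2 (by positivity)
  -- Lebesgue measure is absolutely continuous with respect to the Gaussian, so the set is not null
  -- for `γ` either.
  have hγ : γ (boundedEnergies V k N) ≠ 0 := fun h =>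
    hvol (gaussianReal_absolutelyContinuous' 0 one_ne_zero h)
  set p := (γ (boundedEnergies V k N)).toReal
  have hp : 0 < p := ENNReal.toReal_pos hγ (measure_ne_top _ _)
  have hpe : ENNReal.ofReal p = γ (boundedEnergies V k N) :=
    ENNReal.ofReal_toReal (measure_ne_top _ _)
  refine ⟨Real.exp (-1) * p / (4 * N ^ 2 * Real.sqrt (2 * Real.pi)), Real.exp 1 * (2 * d + B),
    |Real.log (2 * N)|, by positivity, by positivity, abs_nonneg _, ?_⟩
  intro T hT φ hφ S hS hRS
  refine le_trans ?_ (lintegral_energyAmplitude_le_transport V hV (fun n => (hφ n).le) k hT)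
  have hmeas : Measurable fun E => ∑' n, ENNReal.ofReal (φ n) *
      ‖energyAmplitude V hV k T E n‖ₑ ^ 2 :=
    Measurable.tsum fun n => ((measurable_truncatedFourier
      (continuous_evolution V hV k n) T).enorm.pow_const 2).const_mul _
  have hmarkov := mul_meas_ge_le_lintegral (μ := γ) hmeas
    (ENNReal.ofReal (T ^ 2 / (4 * N ^ 2 * S)))
  -- No measurability of `boundedEnergies` is needed: Markov's inequality is applied to the
  -- superlevel set of a measurable function, and outer measure is monotone.
  have hsub : boundedEnergies V k N ⊆ {E | ENNReal.ofReal (T ^ 2 / (4 * N ^ 2 * S)) ≤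
      ∑' n, ENNReal.ofReal (φ n) * ‖energyAmplitude V hV k T E n‖ₑ ^ 2} := fun E hE =>
    le_tsum_weight_energyAmplitude hV hB hN hE hT hφ
      (add_le_add_right (le_abs_self _) _) hS hRS
  refine le_trans (le_of_eq ?_) (mul_le_mul_right
    ((mul_le_mul_right (measure_mono hsub) _).trans hmarkov) _)
  rw [← hpe, ← ENNReal.ofReal_mul (by positivity), ← ENNReal.ofReal_mul (by positivity)]
  congr 1
  field_simp

/-! ### A uniform bound on the eigenfunctions, sums of inverse weights, and the conclusion. -/

/-- The bound relative to `‖ψ k‖` depends on the energy, but countably many bounds exhaust almost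
all of `I`, so one of them serves a non-null set. -/
theorem exists_volume_boundedEnergies_ne_zero {d : ℕ} {V : Lattice d → ℝ} {I : Set ℝ}
    (hI : 0 < volume I) {k : Lattice d}
    (hψ : ∀ᵐ E : ℝ, E ∈ I → ∃ ψ : Lattice d → ℂ,
      IsGeneralizedEigenfunction V (E : ℂ) ψ ∧ ψ k ≠ 0 ∧ ∃ B : ℝ, ∀ n, ‖ψ n‖ ≤ B) :
    ∃ N : ℝ, 0 < N ∧ volume (boundedEnergies V k N) ≠ 0 := by
  have hsub : I ≤ᵐ[volume] ⋃ N : ℕ, boundedEnergies V k (N + 1) := by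
    filter_upwards [hψ] with E hE hEI
    obtain ⟨ψ, hψ, hk, B, hB⟩ := hE hEI
    have hk' : 0 < ‖ψ k‖ := norm_pos_iff.2 hk
    obtain ⟨N, hN⟩ := exists_nat_ge (B / ‖ψ k‖)
    refine Set.mem_iUnion.2 ⟨N, ψ, hψ, hk, fun n => (hB n).trans ?_⟩
    rw [← div_le_iff₀ hk']
    linarith
  by_contra! h
  have h0 : volume (⋃ N : ℕ, boundedEnergies V k (N + 1)) = 0 :=
    measure_iUnion_null fun N => h _ (by positivity)
  exact hI.ne' (measure_mono_null_ae hsub h0)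

/-- Split `⟨n⟩^{-q} = ⟨n⟩^{s-q} ⟨n⟩^{-s}`: the first factor is bounded on the ball, the second is
summable. Taking `s = q` removes the dependence on `R`; a larger `s` allows `q ≤ d`. -/
theorem tsum_ofReal_inv_japaneseBracket_le {d : ℕ} {s q : ℝ} (hs : (d : ℝ) < s) (hsq : q ≤ s)
    (k : Lattice d) {R : ℝ} (hR : 0 ≤ R) :
    ∑' n, (if ‖n - k‖ ≤ R then ENNReal.ofReal (japaneseBracket n ^ q)⁻¹ else 0) ≤
      ENNReal.ofReal ((1 + ‖k‖ + R) ^ (s - q) * ∑' n : Lattice d, japaneseBracket n ^ (-s)) := by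
  have hpos : ∀ n : Lattice d, 0 < japaneseBracket n := fun n =>
    zero_lt_one.trans_le (one_le_japaneseBracket n)
  rw [← tsum_mul_left, ENNReal.ofReal_tsum_of_nonneg
    (fun n => mul_nonneg (by positivity) (Real.rpow_nonneg (hpos n).le _))
    ((summable_japaneseBracket_rpow_neg hs).mul_left _)]
  refine ENNReal.tsum_le_tsum fun n => ?_
  split_ifs with h
  · refine ENNReal.ofReal_le_ofReal ?_
    rw [← Real.rpow_neg (hpos n).le, show -q = (s - q) + -s by ring, Real.rpow_add (hpos n)]
    refine mul_le_mul_of_nonneg_right ?_ (Real.rpow_nonneg (hpos n).le _)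
    refine Real.rpow_le_rpow (hpos n).le ((japaneseBracket_le n).trans ?_) (by linarith)
    have := norm_sub_norm_le n k
    linarith
  · exact zero_le

end LatticeTransport

end

open LatticeTransport in
theorem corollary2p4 (d : ℕ) (hd : 1 ≤ d)
    (V : Lattice d → ℝ) (hV : IsBoundedPotential V)
    (I : Set ℝ) (hI : 0 < volume I) (k : Lattice d)
    (hψ : ∀ᵐ E : ℝ, E ∈ I → ∃ ψ : Lattice d → ℂ,
      IsGeneralizedEigenfunction V (E : ℂ) ψ ∧ ψ k ≠ 0 ∧ ∃ B : ℝ, ∀ n, ‖ψ n‖ ≤ B) :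
    (∀ q : ℝ, (d : ℝ) < q →
      ∃ C : ℝ, 0 < C ∧ ∀ T : ℝ, 0 < T → ENNReal.ofReal (C * T) ≤ moment V hV q k T) ∧
    (∀ q : ℝ, (d : ℝ) - 1 < q → q ≤ d → ∀ r : ℝ, r < 1 + q - d →
      ∃ C : ℝ, 0 < C ∧ ∀ T : ℝ, 0 < T → (0 ≤ r ∨ 1 ≤ T) →
        ENNReal.ofReal (C * T ^ r) ≤ moment V hV q k T) := by
  obtain ⟨N, hN, hvol⟩ := exists_volume_boundedEnergies_ne_zero hI hψ
  obtain ⟨c, a, b, hc, ha, hb, hcore⟩ := exists_le_transport hV hN hvol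
  have hpos : ∀ (s : ℝ) (n : Lattice d), 0 < japaneseBracket n ^ s := fun s n =>
    Real.rpow_pos_of_pos (zero_lt_one.trans_le (one_le_japaneseBracket n)) _
  have hsum : ∀ s : ℝ, (d : ℝ) < s → 0 < ∑' n : Lattice d, japaneseBracket n ^ (-s) := fun s hs =>
    (summable_japaneseBracket_rpow_neg hs).tsum_pos (fun n => (hpos _ n).le) 0 (hpos _ 0)
  refine ⟨fun q hq => ?_, fun q hq hqd r hr => ?_⟩
  · refine ⟨c / ∑' n : Lattice d, japaneseBracket n ^ (-q), div_pos hc (hsum q hq), fun T hT => ?_⟩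
    rw [div_mul_eq_mul_div]
    refine hcore T hT _ (hpos q) _ (hsum q hq)
      ((tsum_ofReal_inv_japaneseBracket_le hq le_rfl k (by positivity)).trans_eq ?_)
    rw [sub_self, Real.rpow_zero, one_mul]
  -- The exponent `s = 1 + q - r` exceeds `d` exactly when `r < 1 + q - d`, and makes `S` of order
  -- `T^{s-q} = T^{1-r}`.
  · have hs : (d : ℝ) < 1 + q - r := by linarith
    set σ := ∑' n : Lattice d, japaneseBracket n ^ (-(1 + q - r)) with hσ
    have hσ0 : 0 < σ := hsum _ hs
    -- For `T ≥ 1`, `1 + ‖k‖ + (a T + b) ≤ m T`.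
    set m := 1 + ‖k‖ + a + b with hm
    have hm0 : 0 < m := by positivity
    have hlarge : ∀ T : ℝ, 1 ≤ T →
        ENNReal.ofReal (c / (m ^ (1 - r) * σ) * T ^ r) ≤ moment V hV q k T := by
      intro T hT1
      have hT : 0 < T := zero_lt_one.trans_le hT1
      have h := hcore T hT (fun n => japaneseBracket n ^ q) (hpos q) ((m * T) ^ (1 - r) * σ)
        (by positivity)
        ((tsum_ofReal_inv_japaneseBracket_le hs (by linarith) k (by positivity)).trans
          (ENNReal.ofReal_le_ofReal ?_))
      · refine le_trans (le_of_eq ?_) h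
        congr 1
        rw [Real.mul_rpow hm0.le hT.le, Real.rpow_sub hT, Real.rpow_one]
        have := Real.rpow_pos_of_pos hT r
        have := Real.rpow_pos_of_pos hm0 (1 - r)
        field_simp
      · rw [show 1 + q - r - q = 1 - r by ring]
        refine mul_le_mul_of_nonneg_right (Real.rpow_le_rpow (by positivity) ?_ (by linarith))
          hσ0.le
        nlinarith [norm_nonneg k]
    refine ⟨min (c / (m ^ (1 - r) * σ)) (Real.exp (-1)),
      lt_min (by positivity) (Real.exp_pos _), fun T hT hrT => ?_⟩
    rcases le_or_gt 1 T with h1 | h1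
    · refine le_trans (ENNReal.ofReal_le_ofReal ?_) (hlarge T h1)
      gcongr
      exact min_le_left _ _
    · have hr0 : 0 ≤ r := hrT.resolve_right (not_le.2 h1)
      -- With `d ≥ 1`, the assumption `q > d - 1` gives `q > 0`, so the weight is at least `1`. Also
      -- `T^r ≤ 1`, since `T < 1` and `r ≥ 0`.
      have hd1 : (1 : ℝ) ≤ d := by exact_mod_cast hd
      refine le_trans (ENNReal.ofReal_le_ofReal ?_) (exp_neg_one_le_transport V hV (fun n =>
        Real.one_le_rpow (one_le_japaneseBracket n) (by linarith)) k hT)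
      calc _ ≤ Real.exp (-1) * 1 := by
            gcongr
            · exact min_le_right _ _
            · exact Real.rpow_le_one hT.le h1.le hr0
        _ = _ := mul_one _
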